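/- Local maximum principle for the $\Gamma$-hull. For each $z\in\mathbb C^k$ let $\Gamma_z$ be a closed cone of $(1,0)$-vectors at $z$ containing a nonzero vector, and assume that $\Gamma=\bigcup_{z\in\mathbb C^k}\{z\}\times\Gamma_z$ is closed in $\mathbb C^k\times\mathbb C^k$ (a $(1,0)$-vector $\sum_j\xi_j\,\partial/\partial z_j$ is identified with $\xi\in\mathbb C^k$). Let $\mathcal P_\Gamma$ be the set of real-valued $u\in\mathcal C^2(\mathbb C^k)$ such that $$\sum_{j,l}\frac{\partial^2u}{\partial z_j\partial\bar z_l}(z)\,\xi_j\bar\xi_l\ge 0\qquad\text{for all } z\in\mathbb C^k,\ \xi\in\Gamma_z,$$ and let $\overline{\mathcal P}_\Gamma$ be the set of pointwise limits $v:\mathbb C^k\to[-\infty,\infty)$ of decreasing sequences of functions in $\mathcal P_\Gamma$. For a compact set $K\subset\mathbb C^k$ let $$\widehat K_\Gamma=\{z\in\mathbb C^k:\ u(z)\le\sup_K u\ \text{ for every } u\in\mathcal P_\Gamma\}.$$ Let $K\subset\mathbb C^k$ be compact and let $U\Subset\mathbb C^k$ be open. Then for every $v\in\overline{\mathcal P}_\Gamma$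 and every $x\in U\cap\widehat K_\Gamma$, $$v(x)\le\sup_{(\partial U\cap\widehat K_\Gamma)\cup(U\cap K)}v .$$ Likewise (Rossi's local maximum principle for plurisubharmonic functions), let $\mathcal P_0$ be the set of smooth ($\mathcal C^\infty$) plurisubharmonic functions on $\mathbb C^k$ and $\widehat K=\{z\in\mathbb C^k:\ u(z)\le\sup_K u\ \text{ for every } u\in\mathcal P_0\}$. Then for every pointwise limit $v:\mathbb C^k\to[-\infty,\infty)$ of a decreasing sequence in $\mathcal P_0$ and every $x\in U\cap\widehat K$, $$v(x)\le\sup_{(\partial U\cap\widehat K)\cup(U\cap K)}v .$$ Here suprema are taken in $[-\infty,\infty]$, with $\sup_\emptyset=-\infty$. -/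

import Mathlib

open Filter Topology
open scoped ContDiff

noncomputable section

namespace GammaHull

/-- The space `ℂ^k` with its Euclidean norm. A `(1,0)`-vector `∑ j, ξ j ∂/∂z_j` at a point is
identified with its coefficient vector `ξ`. -/
abbrev Cn (k : ℕ) : Type := EuclideanSpace ℂ (Fin k)

/-- The second real derivative of `u` at `z` in the directions `v`, `w`. -/
def secondDeriv {k : ℕ} (u : Cn k → ℝ) (z v w : Cn k) : ℝ :=
  fderiv ℝ (fderiv ℝ u) z v w

/-- The vector `∂/∂x_j`, where `z_j = x_j + i y_j`. -/
def dx {k : ℕ} (j : Fin k) : Cn k := EuclideanSpace.single j 1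

/-- The vector `∂/∂y_j`, where `z_j = x_j + i y_j`. -/
def dy {k : ℕ} (j : Fin k) : Cn k := EuclideanSpace.single j Complex.I

/-- The complex Hessian entry `∂²u / ∂z_j ∂z̄_l`, where `∂/∂z_j = (∂/∂x_j - i ∂/∂y_j) / 2` and
`∂/∂z̄_l = (∂/∂x_l + i ∂/∂y_l) / 2`. -/
def complexHessian {k : ℕ} (u : Cn k → ℝ) (z : Cn k) (j l : Fin k) : ℂ :=
  ((secondDeriv u z (dx j) (dx l) + secondDeriv u z (dy j) (dy l) : ℝ) +
    (secondDeriv u z (dx j) (dy l) - secondDeriv u z (dy j) (dx l) : ℝ) * Complex.I) / 4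

/-- The Levi form `∑ j l, (∂²u / ∂z_j ∂z̄_l)(z) ξ_j ξ̄_l`, that is, `i∂∂̄u(z)` evaluated on the
bivector `iξ ∧ ξ̄` up to a positive constant. For `u` of class `C²` the sum is real. -/
def leviForm {k : ℕ} (u : Cn k → ℝ) (z ξ : Cn k) : ℝ :=
  (∑ j, ∑ l, complexHessian u z j l * ξ j * (starRingEnd ℂ) (ξ l)).re

/-- The Levi form is a quarter of the real Laplacian of `ζ ↦ u (z + ζ ξ)` at `ζ = 0`. -/
theorem leviForm_eq {k : ℕ} (u : Cn k → ℝ) (z ξ : Cn k) :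
    leviForm u z ξ =
      (secondDeriv u z ξ ξ + secondDeriv u z (Complex.I • ξ) (Complex.I • ξ)) / 4 := by
  have h1 : ξ = ∑ j, ((ξ j).re • dx j + (ξ j).im • dy j : Cn k) := by
    ext i
    simp [dx, dy, Finset.sum_apply, Pi.single_apply, Finset.sum_add_distrib, Complex.re_add_im]
  have h2 : Complex.I • ξ = ∑ j, ((-(ξ j).im) • dx j + (ξ j).re • dy j : Cn k) := by
    ext i
    simp [dx, dy, Finset.sum_apply, Pi.single_apply, Finset.sum_add_distrib]
    apply Complex.ext <;> simp
  have key : ∀ a b : Fin k → ℝ,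
      secondDeriv u z (∑ j, (a j • dx j + b j • dy j : Cn k))
        (∑ j, (a j • dx j + b j • dy j : Cn k)) =
      ∑ j, ∑ l, (a j * a l * secondDeriv u z (dx j) (dx l)
        + a j * b l * secondDeriv u z (dx j) (dy l)
        + b j * a l * secondDeriv u z (dy j) (dx l)
        + b j * b l * secondDeriv u z (dy j) (dy l)) := by
    intro a b
    simp only [secondDeriv, map_sum, sum_apply, map_add, map_smul,
      add_apply, smul_apply, smul_eq_mul]
    rw [Finset.sum_comm]
    refine Finset.sum_congr rfl fun j _ => ?_
    rw [Finset.mul_sum, Finset.mul_sum, ← Finset.sum_add_distrib]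
    refine Finset.sum_congr rfl fun l _ => ?_
    ring
  rw [h2, show secondDeriv u z ξ ξ = _ from by rw [h1, key], key, leviForm, Complex.re_sum,
    ← Finset.sum_add_distrib, Finset.sum_div]
  refine Finset.sum_congr rfl fun j _ => ?_
  rw [Complex.re_sum, ← Finset.sum_add_distrib, Finset.sum_div]
  refine Finset.sum_congr rfl fun l _ => ?_
  simp [complexHessian]
  ring

/-- A closed field `z ↦ Γ z` of closed cones of `(1,0)`-vectors on `ℂ^k`, each of which contains
a nonzero vector. -/
structure IsClosedConeField {k : ℕ} (Γ : Cn k → Set (Cn k)) : Prop where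
  smul_mem : ∀ z, ∀ ξ ∈ Γ z, ∀ t : ℝ, 0 < t → t • ξ ∈ Γ z
  isClosed_fiber : ∀ z, IsClosed (Γ z)
  exists_ne_zero : ∀ z, ∃ ξ ∈ Γ z, ξ ≠ 0
  isClosed_total : IsClosed {p : Cn k × Cn k | p.2 ∈ Γ p.1}

/-- The cone of real `C²` functions on `ℂ^k` whose Levi form at each `z` is nonnegative
on `Γ z`. -/
def coneP {k : ℕ} (Γ : Cn k → Set (Cn k)) : Set (Cn k → ℝ) :=
  {u | ContDiff ℝ 2 u ∧ ∀ z, ∀ ξ ∈ Γ z, 0 ≤ leviForm u z ξ}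

/-- The cone of smooth plurisubharmonic functions on `ℂ^k`. -/
def smoothPsh (k : ℕ) : Set (Cn k → ℝ) :=
  {u | ContDiff ℝ ∞ u ∧ ∀ z ξ, 0 ≤ leviForm u z ξ}

/-- The pointwise limits, with values in `[-∞, ∞)`, of decreasing sequences of functions
of `P`. -/
def decreasingLimits {k : ℕ} (P : Set (Cn k → ℝ)) : Set (Cn k → EReal) :=
  {v | ∃ u : ℕ → Cn k → ℝ, (∀ n, u n ∈ P) ∧ Antitone u ∧
    ∀ z, Tendsto (fun n => (u n z : EReal)) atTop (𝓝 (v z))}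

/-- The hull of `K` with respect to `P`: the points `z` with `u z ≤ sup_K u` for all `u ∈ P`.
The supremum is taken in `[-∞, ∞]`, so the hull of the empty set is empty if `P` is not. -/
def hull {k : ℕ} (P : Set (Cn k → ℝ)) (K : Set (Cn k)) : Set (Cn k) :=
  {z | ∀ u ∈ P, (u z : EReal) ≤ ⨆ y ∈ K, (u y : EReal)}

end GammaHull

end

namespace GammaHull

/-! ### A smooth convex ramp -/

/-! If `v` is negative on the comparison set but positive at `x`, a competitor in the cone
contradicts `x` lying in the hull. Points of the frontier where `v ≥ 0` lie off the hull, so by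
compactness some `g ≥ 0` in the cone vanishes on `K` and exceeds `v` there, hence on the whole
frontier (`exists_leviCone_separating_compact`). Let `f` be a smoothed `max(v, g)` in `U` and `g`
elsewhere. The pieces agree near the frontier, so `f` is in the cone; it vanishes on `K` but is
positive at `x` (`leviCone_local_maximum`).

The smoothing is `g + χ(v - g)` with `χ` convex and `0 ≤ χ' ≤ 1`: its Levi form is at least the
convex combination of those of `v` and `g` with weights `χ'` and `1 - χ'`. Decreasing limits follow
by a Dini argument. Both claims are instances of `leviCone`, with `n = 2`, and with `n = ∞` and full
fibres. -/

theorem expNegInvGlue_monotone : Monotone expNegInvGlue := by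
  intro x y hxy
  rcases le_or_gt x 0 with hx | hx
  · rw [expNegInvGlue.zero_of_nonpos hx]
    exact expNegInvGlue.nonneg y
  · have hy : 0 < y := hx.trans_le hxy
    simp only [expNegInvGlue, not_le.2 hx, not_le.2 hy, if_false]
    gcongr

theorem expNegInvGlue_le_one (x : ℝ) : expNegInvGlue x ≤ 1 := by
  rcases le_or_gt x 0 with hx | hx
  · rw [expNegInvGlue.zero_of_nonpos hx]
    exact zero_le_one
  · simp only [expNegInvGlue, not_le.2 hx, if_false]
    exact Real.exp_le_one_iff.2 (neg_nonpos.2 (inv_nonneg.2 hx.le))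

/-- A smooth convex nondecreasing function which vanishes exactly on `(-∞, 0]` and has slope at
most `1`. -/
noncomputable def smoothRamp (t : ℝ) : ℝ := ∫ s in (0 : ℝ)..t, expNegInvGlue s

theorem hasDerivAt_smoothRamp (t : ℝ) : HasDerivAt smoothRamp (expNegInvGlue t) t :=
  (expNegInvGlue.contDiff (n := 0)).continuous.integral_hasStrictDerivAt 0 t |>.hasDerivAt

theorem deriv_smoothRamp : deriv smoothRamp = expNegInvGlue :=
  funext fun t => (hasDerivAt_smoothRamp t).deriv

theorem contDiff_smoothRamp : ContDiff ℝ ∞ smoothRamp := by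
  refine contDiff_infty_iff_deriv.2 ⟨fun t => (hasDerivAt_smoothRamp t).differentiableAt, ?_⟩
  rw [deriv_smoothRamp]
  exact expNegInvGlue.contDiff

theorem smoothRamp_of_nonpos {t : ℝ} (ht : t ≤ 0) : smoothRamp t = 0 := by
  rw [smoothRamp, intervalIntegral.integral_congr (g := fun _ => (0 : ℝ))]
  · simp
  · intro s hs
    rw [Set.uIcc_of_ge ht] at hs
    exact expNegInvGlue.zero_of_nonpos hs.2

theorem smoothRamp_pos {t : ℝ} (ht : 0 < t) : 0 < smoothRamp t :=
  intervalIntegral.intervalIntegral_pos_of_pos_on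
    ((expNegInvGlue.contDiff (n := 0)).continuous.intervalIntegrable 0 t)
    (fun _ hs => expNegInvGlue.pos_of_pos hs.1) ht

theorem smoothRamp_nonneg (t : ℝ) : 0 ≤ smoothRamp t := by
  rcases le_or_gt t 0 with ht | ht
  · exact (smoothRamp_of_nonpos ht).ge
  · exact (smoothRamp_pos ht).le

/-! ### Calculus of the Levi form -/

variable {k : ℕ}

theorem two_le_infty : (2 : WithTop ℕ∞) ≤ ∞ :=
  WithTop.coe_le_coe.2 le_top

theorem differentiable_fderiv {u : Cn k → ℝ} (hu : ContDiff ℝ 2 u) :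
    Differentiable ℝ (fderiv ℝ u) :=
  (hu.fderiv_right (m := 1) (by norm_num)).differentiable (by norm_num)

theorem secondDeriv_add {u w : Cn k → ℝ} (hu : ContDiff ℝ 2 u) (hw : ContDiff ℝ 2 w)
    (z a b : Cn k) :
    secondDeriv (u + w) z a b = secondDeriv u z a b + secondDeriv w z a b := by
  have h : fderiv ℝ (u + w) = fderiv ℝ u + fderiv ℝ w := funext fun x =>
    fderiv_add (hu.differentiable two_ne_zero x) (hw.differentiable two_ne_zero x)
  rw [secondDeriv, h, fderiv_add (differentiable_fderiv hu z) (differentiable_fderiv hw z)]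
  rfl

theorem secondDeriv_const_smul {u : Cn k → ℝ} (hu : ContDiff ℝ 2 u) (c : ℝ) (z a b : Cn k) :
    secondDeriv (c • u) z a b = c * secondDeriv u z a b := by
  have h : fderiv ℝ (c • u) = c • fderiv ℝ u := funext fun x =>
    fderiv_const_smul (hu.differentiable two_ne_zero x) c
  rw [secondDeriv, h, fderiv_const_smul (differentiable_fderiv hu z)]
  rfl

theorem secondDeriv_comp {χ : ℝ → ℝ} {u : Cn k → ℝ} (hχ : ContDiff ℝ 2 χ)
    (hu : ContDiff ℝ 2 u) (z a b : Cn k) :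
    secondDeriv (χ ∘ u) z a b = deriv χ (u z) * secondDeriv u z a b +
      deriv (deriv χ) (u z) * fderiv ℝ u z a * fderiv ℝ u z b := by
  have h : fderiv ℝ (χ ∘ u) = fun x => deriv χ (u x) • fderiv ℝ u x := funext fun x =>
    ((hχ.differentiable two_ne_zero (u x)).hasDerivAt.comp_hasFDerivAt x
      (hu.differentiable two_ne_zero x).hasFDerivAt).fderiv
  have h1 : Differentiable ℝ (deriv χ) :=
    (contDiff_succ_iff_deriv (n := 1).1 (by rwa [one_add_one_eq_two])).2.2.differentiable one_ne_zero
  have h2 : HasFDerivAt (fun x => deriv χ (u x)) (deriv (deriv χ) (u z) • fderiv ℝ u z) z :=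
    (h1 (u z)).hasDerivAt.comp_hasFDerivAt z (hu.differentiable two_ne_zero z).hasFDerivAt
  rw [secondDeriv, h, show (fun x => deriv χ (u x) • fderiv ℝ u x) = (fun x => deriv χ (u x)) • fderiv ℝ u from rfl,
    (h2.smul (differentiable_fderiv hu z).hasFDerivAt).fderiv]
  simp [secondDeriv]

theorem leviForm_add {u w : Cn k → ℝ} (hu : ContDiff ℝ 2 u) (hw : ContDiff ℝ 2 w) (z ξ : Cn k) :
    leviForm (u + w) z ξ = leviForm u z ξ + leviForm w z ξ := by
  simp only [leviForm_eq, secondDeriv_add hu hw]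
  ring

theorem leviForm_const_smul {u : Cn k → ℝ} (hu : ContDiff ℝ 2 u) (c : ℝ) (z ξ : Cn k) :
    leviForm (c • u) z ξ = c * leviForm u z ξ := by
  simp only [leviForm_eq, secondDeriv_const_smul hu]
  ring

theorem leviForm_comp {χ : ℝ → ℝ} {u : Cn k → ℝ} (hχ : ContDiff ℝ 2 χ) (hu : ContDiff ℝ 2 u)
    (z ξ : Cn k) :
    leviForm (χ ∘ u) z ξ = deriv χ (u z) * leviForm u z ξ + deriv (deriv χ) (u z) *
      (fderiv ℝ u z ξ ^ 2 + fderiv ℝ u z (Complex.I • ξ) ^ 2) / 4 := by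
  simp only [leviForm_eq, secondDeriv_comp hχ hu]
  ring

theorem leviForm_congr {u w : Cn k → ℝ} {z : Cn k} (h : u =ᶠ[𝓝 z] w) (ξ : Cn k) :
    leviForm u z ξ = leviForm w z ξ := by
  simp only [leviForm_eq, secondDeriv, h.fderiv.fderiv_eq]

theorem leviForm_const (c : ℝ) (z ξ : Cn k) : leviForm (fun _ => c) z ξ = 0 := by
  have h : fderiv ℝ (fun _ : Cn k => c) = fun _ => 0 := funext fun x => fderiv_const_apply c
  simp [leviForm_eq, secondDeriv, h]

/-- By convexity of the ramp, the gradient term in the chain rule is nonnegative and can be dropped.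
-/
theorem leviForm_smoothRamp_comp_ge {u : Cn k → ℝ} (hu : ContDiff ℝ 2 u) (z ξ : Cn k) :
    expNegInvGlue (u z) * leviForm u z ξ ≤ leviForm (smoothRamp ∘ u) z ξ := by
  rw [leviForm_comp (contDiff_smoothRamp.of_le two_le_infty) hu, deriv_smoothRamp]
  have h := expNegInvGlue_monotone.deriv_nonneg (x := u z)
  have : 0 ≤ deriv expNegInvGlue (u z) *
      (fderiv ℝ u z ξ ^ 2 + fderiv ℝ u z (Complex.I • ξ) ^ 2) / 4 := by positivity
  linarith

/-! ### Cones of functions with nonnegative Levi form -/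

/-- The functions of class `C^n` whose Levi form at each `z` is nonnegative on `Γ z`. -/
def leviCone (n : WithTop ℕ∞) (Γ : Cn k → Set (Cn k)) : Set (Cn k → ℝ) :=
  {u | ContDiff ℝ n u ∧ ∀ z, ∀ ξ ∈ Γ z, 0 ≤ leviForm u z ξ}

variable {n : WithTop ℕ∞} {Γ : Cn k → Set (Cn k)}

theorem const_mem_leviCone (c : ℝ) : (fun _ => c) ∈ leviCone n Γ :=
  ⟨contDiff_const, fun z ξ _ => (leviForm_const c z ξ).ge⟩

theorem add_mem_leviCone (hn : 2 ≤ n) {u w : Cn k → ℝ} (hu : u ∈ leviCone n Γ)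
    (hw : w ∈ leviCone n Γ) : u + w ∈ leviCone n Γ := by
  refine ⟨hu.1.add hw.1, fun z ξ hξ => ?_⟩
  rw [leviForm_add (hu.1.of_le hn) (hw.1.of_le hn)]
  exact add_nonneg (hu.2 z ξ hξ) (hw.2 z ξ hξ)

theorem const_smul_mem_leviCone (hn : 2 ≤ n) {u : Cn k → ℝ} (hu : u ∈ leviCone n Γ) {c : ℝ}
    (hc : 0 ≤ c) : c • u ∈ leviCone n Γ := by
  refine ⟨contDiff_const.smul hu.1, fun z ξ hξ => ?_⟩
  rw [leviForm_const_smul (hu.1.of_le hn)]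
  exact mul_nonneg hc (hu.2 z ξ hξ)

theorem sum_mem_leviCone (hn : 2 ≤ n) {ι : Type*} (s : Finset ι) {u : ι → Cn k → ℝ}
    (hu : ∀ i ∈ s, u i ∈ leviCone n Γ) : ∑ i ∈ s, u i ∈ leviCone n Γ :=
  Finset.sum_induction u (· ∈ leviCone n Γ) (fun _ _ => add_mem_leviCone hn)
    (const_mem_leviCone 0) hu

theorem smoothRamp_comp_mem_leviCone (hn : 2 ≤ n) (hn' : n ≤ ∞) {u : Cn k → ℝ}
    (hu : u ∈ leviCone n Γ) : smoothRamp ∘ u ∈ leviCone n Γ :=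
  ⟨(contDiff_smoothRamp.of_le hn').comp hu.1, fun z ξ hξ =>
    (mul_nonneg (expNegInvGlue.nonneg _) (hu.2 z ξ hξ)).trans
      (leviForm_smoothRamp_comp_ge (hu.1.of_le hn) z ξ)⟩

/-- A regularised maximum of `u` and `w`. -/
theorem add_smoothRamp_comp_sub_mem_leviCone (hn : 2 ≤ n) (hn' : n ≤ ∞) {u w : Cn k → ℝ}
    (hu : u ∈ leviCone n Γ) (hw : w ∈ leviCone n Γ) :
    w + smoothRamp ∘ (u - w) ∈ leviCone n Γ := by
  have hd : ContDiff ℝ n (u - w) := hu.1.sub hw.1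
  have hχd := (contDiff_smoothRamp.of_le hn').comp hd
  refine ⟨hw.1.add hχd, fun z ξ hξ => ?_⟩
  have h1 : leviForm u z ξ = leviForm w z ξ + leviForm (u - w) z ξ := by
    rw [← leviForm_add (hw.1.of_le hn) (hd.of_le hn), add_sub_cancel]
  rw [leviForm_add (hw.1.of_le hn) (hχd.of_le hn)]
  have h2 := leviForm_smoothRamp_comp_ge (hd.of_le hn) z ξ
  have h3 := hu.2 z ξ hξ
  have h4 := hw.2 z ξ hξ
  have h5 := expNegInvGlue.nonneg ((u - w) z)
  have h6 := expNegInvGlue_le_one ((u - w) z)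
  -- With `χ'` the slope of the ramp, `L(w) + χ' L(u - w) = χ' L(u) + (1 - χ') L(w)`; this uses `0 ≤
  -- χ' ≤ 1`.
  nlinarith [mul_nonneg h5 h3, mul_nonneg (sub_nonneg.2 h6) h4]

theorem mem_leviCone_of_eventuallyEq {f : Cn k → ℝ}
    (h : ∀ z, ∃ g ∈ leviCone n Γ, f =ᶠ[𝓝 z] g) : f ∈ leviCone n Γ := by
  refine ⟨contDiff_iff_contDiffAt.2 fun z => ?_, fun z ξ hξ => ?_⟩
  · obtain ⟨g, hg, hfg⟩ := h z
    exact hg.1.contDiffAt.congr_of_eventuallyEq hfg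
  · obtain ⟨g, hg, hfg⟩ := h z
    rw [leviForm_congr hfg]
    exact hg.2 z ξ hξ

/-! ### The local maximum principle -/

theorem subset_hull (P : Set (Cn k → ℝ)) (K : Set (Cn k)) : K ⊆ hull P K :=
  fun z hz u _ => le_iSup₂ (f := fun y (_ : y ∈ K) => (u y : EReal)) z hz

theorem nonpos_of_mem_hull {P : Set (Cn k → ℝ)} {K : Set (Cn k)} {x : Cn k} (hx : x ∈ hull P K)
    {f : Cn k → ℝ} (hf : f ∈ P) (h : ∀ y ∈ K, f y ≤ 0) : f x ≤ 0 := by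
  have : (f x : EReal) ≤ 0 := (hx f hf).trans (iSup₂_le fun y hy => mod_cast h y hy)
  exact_mod_cast this

/-- For a real `a` strictly between `sup_K u` and `u y`, the ramp of `u - a` vanishes on `K` and is
positive at `y`; a positive multiple is then as large as desired at `y`. -/
theorem exists_leviCone_separating (hn : 2 ≤ n) (hn' : n ≤ ∞) {K : Set (Cn k)} {y : Cn k}
    (hy : y ∉ hull (leviCone n Γ) K) (M : ℝ) :
    ∃ g ∈ leviCone n Γ, (∀ z, 0 ≤ g z) ∧ (∀ z ∈ K, g z = 0) ∧ M < g y := by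
  simp only [hull, Set.mem_ofPred_eq, not_forall, not_le] at hy
  obtain ⟨u, hu, huy⟩ := hy
  obtain ⟨a, ha, hay⟩ := EReal.lt_iff_exists_real_btwn.1 huy
  have hay' : a < u y := mod_cast hay
  have hw := smoothRamp_comp_mem_leviCone hn hn' (add_mem_leviCone hn hu (const_mem_leviCone (-a)))
  have hpos : 0 < smoothRamp (u y + -a) := smoothRamp_pos (by linarith)
  refine ⟨((|M| + 1) / smoothRamp (u y + -a)) • _,
    const_smul_mem_leviCone hn hw (by positivity), fun z => ?_, fun z hz => ?_, ?_⟩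
  · exact mul_nonneg (by positivity) (smoothRamp_nonneg _)
  · have hz' : (u z : EReal) < a :=
      (le_iSup₂ (f := fun y (_ : y ∈ K) => (u y : EReal)) z hz).trans_lt ha
    have hz'' : u z < a := mod_cast hz'
    simp [smoothRamp_of_nonpos (show u z + -a ≤ 0 by linarith)]
  · simp only [Pi.smul_apply, Function.comp_apply, Pi.add_apply, smul_eq_mul]
    rw [div_mul_cancel₀ _ hpos.ne']
    linarith [le_abs_self M]

/-- Since the separating functions are nonnegative, a finite sum dominates each summand, so a finite
subcover suffices. -/
theorem exists_leviCone_separating_compact (hn : 2 ≤ n) (hn' : n ≤ ∞) {K B : Set (Cn k)}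
    (hB : IsCompact B) (hBK : Disjoint B (hull (leviCone n Γ) K)) {v : Cn k → ℝ}
    (hv : Continuous v) :
    ∃ g ∈ leviCone n Γ, (∀ z, 0 ≤ g z) ∧ (∀ z ∈ K, g z = 0) ∧ ∀ y ∈ B, v y < g y := by
  choose! g hg hg0 hgK hgv using fun y (hy : y ∈ B) =>
    exists_leviCone_separating hn hn' (Set.disjoint_left.1 hBK hy) (v y)
  obtain ⟨t, htB, ht⟩ := hB.elim_nhds_subcover (fun y => {z | v z < g y z}) fun y hy =>
    (isOpen_lt hv (hg y hy).1.continuous).mem_nhds (hgv y hy)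
  refine ⟨∑ y ∈ t, g y, sum_mem_leviCone hn t fun y hy => hg y (htB y hy), fun z => ?_,
    fun z hz => ?_, fun z hz => ?_⟩
  · rw [Finset.sum_apply]
    exact Finset.sum_nonneg fun y hy => hg0 y (htB y hy) z
  · rw [Finset.sum_apply]
    exact Finset.sum_eq_zero fun y hy => hgK y (htB y hy) z hz
  · obtain ⟨y, hy, hyz⟩ := Set.mem_iUnion₂.1 (ht hz)
    rw [Finset.sum_apply]
    exact lt_of_lt_of_le hyz
      (Finset.single_le_sum (f := fun i => g i z) (fun i hi => hg0 i (htB i hi) z) hy)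

open Classical in
theorem leviCone_local_maximum (hn : 2 ≤ n) (hn' : n ≤ ∞) {K U : Set (Cn k)} (hU : IsOpen U)
    (hUc : IsCompact (closure U)) {v : Cn k → ℝ} (hv : v ∈ leviCone n Γ)
    (hvS : ∀ y ∈ (frontier U ∩ hull (leviCone n Γ) K) ∪ (U ∩ K), v y < 0) {x : Cn k}
    (hx : x ∈ U ∩ hull (leviCone n Γ) K) : v x ≤ 0 := by
  have hvc := hv.1.continuous
  have hB : IsCompact (frontier U ∩ {y | 0 ≤ v y}) :=
    (hUc.of_isClosed_subset isClosed_frontier frontier_subset_closure).inter_right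
      (isClosed_le continuous_const hvc)
  obtain ⟨g, hg, hg0, hgK, hgv⟩ := exists_leviCone_separating_compact (Γ := Γ) (K := K) hn hn' hB
    (Set.disjoint_left.2 fun y hy hyK => not_lt.2 hy.2 (hvS y (Or.inl ⟨hy.1, hyK⟩))) hvc
  have hlt : ∀ y ∈ frontier U, v y < g y := fun y hy => by
    rcases lt_or_ge (v y) 0 with h | h
    · exact h.trans_le (hg0 y)
    · exact hgv y ⟨hy, h⟩
  let f : Cn k → ℝ := fun z => if z ∈ U then (g + smoothRamp ∘ (v - g)) z else g z
  have hf : f ∈ leviCone n Γ := by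
    refine mem_leviCone_of_eventuallyEq fun z => ?_
    by_cases hzU : z ∈ U
    · refine ⟨_, add_smoothRamp_comp_sub_mem_leviCone hn hn' hv hg, ?_⟩
      filter_upwards [hU.mem_nhds hzU] with y hy
      exact if_pos hy
    · refine ⟨g, hg, ?_⟩
      by_cases hzc : z ∈ closure U
      · have hzf : z ∈ frontier U := ⟨hzc, by rwa [hU.interior_eq]⟩
        -- Near a frontier point `v < g`, so the ramp term vanishes and both branches of `f` equal
        -- `g`.
        filter_upwards [(isOpen_lt hvc hg.1.continuous).mem_nhds (hlt z hzf)] with y hy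
        have hy' : v y - g y ≤ 0 := sub_nonpos.2 (le_of_lt hy)
        simp [f, smoothRamp_of_nonpos hy']
      · filter_upwards [isClosed_closure.isOpen_compl.mem_nhds hzc] with y hy
        exact if_neg fun h => hy (subset_closure h)
  have hfx : f x ≤ 0 := by
    refine nonpos_of_mem_hull hx.2 hf fun y hy => ?_
    by_cases hyU : y ∈ U
    · simp [f, hgK y hy, smoothRamp_of_nonpos (hvS y (Or.inr ⟨hyU, hy⟩)).le]
    · simp [f, hyU, hgK y hy]
  simp only [f, hx.1, if_true, Pi.add_apply, Function.comp_apply, Pi.sub_apply] at hfx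
  -- Both summands of `f x` are nonnegative, so `f x ≤ 0` forces `g x = 0`; then `v x > 0` makes the
  -- ramp term positive.
  by_contra! hpos
  have h1 := hg0 x
  have h2 := smoothRamp_nonneg (v x - g x)
  have h3 : g x = 0 := by linarith
  have h4 := smoothRamp_pos (t := v x - g x) (by linarith)
  linarith

/-! ### Passage to decreasing limits -/

theorem isClosed_hull {P : Set (Cn k → ℝ)} (hP : ∀ u ∈ P, Continuous u) (K : Set (Cn k)) :
    IsClosed (hull P K) := by
  simp only [hull, Set.ofPred_forall]
  exact isClosed_iInter fun u => isClosed_iInter fun hu =>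
    isClosed_le (continuous_coe_real_ereal.comp (hP u hu)) continuous_const

theorem decreasingLimits_leviCone_local_maximum (hn : 2 ≤ n) (hn' : n ≤ ∞) {K U : Set (Cn k)}
    (hK : IsCompact K) (hU : IsOpen U) (hUc : IsCompact (closure U)) {v : Cn k → EReal}
    (hv : v ∈ decreasingLimits (leviCone n Γ)) {x : Cn k}
    (hx : x ∈ U ∩ hull (leviCone n Γ) K) :
    v x ≤ ⨆ y ∈ (frontier U ∩ hull (leviCone n Γ) K) ∪ (U ∩ K), v y := by
  obtain ⟨u, hu, hanti, hlim⟩ := hv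
  by_contra! hlt
  obtain ⟨c, hc, hcx⟩ := EReal.lt_iff_exists_real_btwn.1 hlt
  have hS : IsCompact ((frontier U ∩ hull (leviCone n Γ) K) ∪ (U ∩ K)) := by
    -- `U ∩ K` need not be closed, but the points of `K` on the frontier are already in the first
    -- set, as `K` lies in its hull.
    have h : (frontier U ∩ hull (leviCone n Γ) K) ∪ (U ∩ K) =
        (frontier U ∩ hull (leviCone n Γ) K) ∪ (closure U ∩ K) := by
      refine subset_antisymm
        (Set.union_subset_union_right _ (Set.inter_subset_inter_left _ subset_closure)) ?_
      rintro y (hy | ⟨hyU, hyK⟩)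
      · exact Or.inl hy
      · by_cases hy : y ∈ U
        · exact Or.inr ⟨hy, hyK⟩
        · exact Or.inl ⟨⟨hyU, by rwa [hU.interior_eq]⟩, subset_hull _ _ hyK⟩
    rw [h]
    exact ((hUc.of_isClosed_subset isClosed_frontier frontier_subset_closure).inter_right
      (isClosed_hull (fun w hw => hw.1.continuous) K)).union (hK.inter_left isClosed_closure)
  -- Dini: the sets `{u m < c}` are open, increase with `m` and cover the compact comparison set, so
  -- one of them contains it.
  obtain ⟨m, hm⟩ := hS.elim_directed_cover (fun m => {z | u m z < c})
    (fun m => isOpen_lt (hu m).1.continuous continuous_const)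
    (fun y hy => by
      have hyc : v y < c := (le_iSup₂ (f := fun y _ => v y) y hy).trans_lt hc
      obtain ⟨m, hm⟩ := ((hlim y).eventually (eventually_lt_nhds hyc)).exists
      exact Set.mem_iUnion.2 ⟨m, EReal.coe_lt_coe_iff.1 hm⟩)
    (directed_of_isDirected_le fun i j hij z hz => (hanti hij z).trans_lt hz)
  have hvx : v x ≤ u m x :=
    Antitone.le_of_tendsto (fun i j hij => EReal.coe_le_coe_iff.2 (hanti hij x)) (hlim x) m
  have h1 : c < u m x := EReal.coe_lt_coe_iff.1 (hcx.trans_le hvx)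
  have h2 := leviCone_local_maximum (v := u m + fun _ => -c) hn hn' hU hUc
    (add_mem_leviCone hn (hu m) (const_mem_leviCone (-c)))
    (fun y hy => by simpa using hm hy) hx
  simp only [Pi.add_apply] at h2
  linarith

theorem smoothPsh_eq_leviCone (k : ℕ) : smoothPsh k = leviCone ∞ (fun _ => Set.univ) := by
  simp [smoothPsh, leviCone]

end GammaHull

theorem corollary3p6 (k : ℕ) (K U : Set (GammaHull.Cn k)) (hK : IsCompact K)
    (hU : IsOpen U) (hUc : IsCompact (closure U)) :
    (∀ Γ : GammaHull.Cn k → Set (GammaHull.Cn k), GammaHull.IsClosedConeField Γ →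
      ∀ v ∈ GammaHull.decreasingLimits (GammaHull.coneP Γ),
      ∀ x ∈ U ∩ GammaHull.hull (GammaHull.coneP Γ) K,
        v x ≤ ⨆ y ∈ (frontier U ∩ GammaHull.hull (GammaHull.coneP Γ) K) ∪ (U ∩ K), v y) ∧
    (∀ v ∈ GammaHull.decreasingLimits (GammaHull.smoothPsh k),
      ∀ x ∈ U ∩ GammaHull.hull (GammaHull.smoothPsh k) K,
        v x ≤ ⨆ y ∈ (frontier U ∩ GammaHull.hull (GammaHull.smoothPsh k) K) ∪ (U ∩ K), v y) := by
  refine ⟨fun Γ _ v hv x hx => ?_, ?_⟩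
  · exact GammaHull.decreasingLimits_leviCone_local_maximum (n := 2) (Γ := Γ) le_rfl
      GammaHull.two_le_infty hK hU hUc hv hx
  · rw [GammaHull.smoothPsh_eq_leviCone]
    exact fun v hv x hx => GammaHull.decreasingLimits_leviCone_local_maximum
      GammaHull.two_le_infty le_rfl hK hU hUc hv hx
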